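/- Let $\tau$ be a finite nonempty set of proposition symbols and let $n,d\ge 1$. Propositional formulas are $\psi ::= p \mid \neg p \mid \psi\wedge\psi \mid \psi\vee\psi$ with $p\in\tau$, and formulas of graded universal modal logic are $$\varphi ::= \mathsf{m}\,\psi \mid \mathsf{m}\,\varphi \mid \varphi\wedge\varphi\mid\varphi\vee\varphi ,\qquad \mathsf m\in\{\Diamond^{\ge k},\Box^{<k},\Diamond^{=k},\Box^{\ne k} : k\in\mathbb N\},\quad 0\in\mathbb N .$$ In a model, $\Diamond^{\ge k}\chi$ (respectively $\Diamond^{=k}\chi$) says that at least (respectively exactly) $k$ points satisfy $\chi$; the boxes are the duals, $\Box^{<k}\chi\equiv\neg\Diamond^{\ge k}\neg\chi$ and $\Box^{\ne k}\chi\equiv\neg\Diamond^{=k}\neg\chi$. A formula is true in a model if it is satisfied at all points. The size of a formula counts $1$ for each occurrence of a literal, $1$ for each occurrence of $\wedge$ or $\vee$, $k$ for each occurrence of $\Diamond^{\ge k}$ or $\Box^{<k}$, and $k+1$ for each occurrence of $\Diamond^{=k}$ or $\Box^{\neq k}$. The logic $\mathrm{GMLU}_d$ consists of the formulas in which every occurring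 $\Diamond^{\ge k}$ or $\Box^{<k}$ has $k\le d$ and every occurring $\Diamond^{=k}$ or $\Box^{\ne k}$ has $k+1\le d$. Let $\mathcal M$ be the set of all $\tau$-models with domain $\{1,\dots,n\}$, and for $\mathfrak M,\mathfrak N\in\mathcal M$ let $\mathfrak M\equiv_d\mathfrak N$ mean that $\mathfrak M$ and $\mathfrak N$ make the same $\mathrm{GMLU}_d$-formulas true. A formula defines $M\subseteq\mathcal M$ if it is true in exactly those models of $\mathcal M$ that belong to $M$. For $M$ definable in $\mathrm{GMLU}_d$, $C(M)$ is the minimum size of a $\mathrm{GMLU}_d$-formula that defines $M$. Let $(\pi_i)_{i\in I}$ enumerate the $2^{|\tau|}$ propositional types over $\tau$ (maximally consistent sets of literals). A tuple $\overline n=(n_i)_{i\in I}$ of natural numbers is $(n,d)$-admissible if $n_i\le d$ for all $i$, $\sum_i n_i\le n$, and either $n_i=d$ for some $i$ or $\sum_i n_i=n$. Let $M_{\overline n}$ be the set of models in $\mathcal M$ in which, for every $i\in I$, the type $\pi_i$ is realized by exactly $n_i$ points if $n_i<d$ and by at least $d$ points if $n_i=d$. Put $c_\tau=2^{|\tau|}(2|\tau|+1)-1$.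 **Theorem.** Let $\overline n$ be $(n,d)$-admissible. Then $M_{\overline n}$ is an equivalence class of $\equiv_d$ and is definable in $\mathrm{GMLU}_d$, and the following hold. 1. If $n_i=d$ for at least two $i\in I$, then $\sum_{i\in I} n_i\le C(M_{\overline n})\le \sum_{i\in I} n_i+c_\tau$. 2. Otherwise, let $\pi_j$ be a type with the most realizing points in a model of $M_{\overline n}$, and let $|\pi_j|$ be the number of points realizing it in that model. Then $\sum_{i\in I\setminus\{j\}} n_i=n-|\pi_j|$ and $n-|\pi_j|\le C(M_{\overline n})\le n-|\pi_j|+c_\tau$. -/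

import Mathlib

namespace GMLU

universe u

/-- Propositional formulas in negation normal form over the proposition symbols `τ`. -/
inductive PropForm (τ : Type u) : Type u where
  | pos (p : τ) : PropForm τ
  | neg (p : τ) : PropForm τ
  | and (ψ₁ ψ₂ : PropForm τ) : PropForm τ
  | or (ψ₁ ψ₂ : PropForm τ) : PropForm τ

/-- The graded global modalities `◇^{≥k}`, `□^{<k}`, `◇^{=k}`, `□^{≠k}`, for `k = 0, 1, 2, …`. -/
inductive Modality : Type where
  | diaGe (k : ℕ) : Modality
  | boxLt (k : ℕ) : Modality
  | diaEq (k : ℕ) : Modality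
  | boxNe (k : ℕ) : Modality

/-- Formulas of graded universal modal logic: a modality applied to a propositional formula,
a modality applied to a formula, conjunctions and disjunctions of formulas. In particular every
proposition symbol is in the scope of a modality. -/
inductive Form (τ : Type u) : Type u where
  | modProp (m : Modality) (ψ : PropForm τ) : Form τ
  | mod (m : Modality) (φ : Form τ) : Form τ
  | and (φ₁ φ₂ : Form τ) : Form τ
  | or (φ₁ φ₂ : Form τ) : Form τ

/-- A `τ`-model with domain of `n` points: `M p w` tells whether `p` is true at the point `w`. -/
abbrev Model (τ : Type u) (n : ℕ) : Type u := τ → Fin n → Bool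

/-- A propositional type over `τ` (a maximally consistent set of literals), given by the choice
of `p` (value `true`) or of its negation (value `false`) for each symbol `p`. -/
abbrev PType (τ : Type u) : Type u := τ → Bool

variable {τ : Type u} {n : ℕ}

/-- Truth of a propositional formula at a point of a model. -/
def PropForm.Sat (M : Model τ n) (w : Fin n) : PropForm τ → Prop
  | .pos p => M p w = true
  | .neg p => M p w = false
  | .and ψ₁ ψ₂ => ψ₁.Sat M w ∧ ψ₂.Sat M w
  | .or ψ₁ ψ₂ => ψ₁.Sat M w ∨ ψ₂.Sat M w

/-- Truth of a modality applied to a property `P` of points. The boxes are the duals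
`□^{<k} P = ¬ ◇^{≥k} ¬ P` and `□^{≠k} P = ¬ ◇^{=k} ¬ P`. -/
def Modality.Holds (P : Fin n → Prop) : Modality → Prop
  | .diaGe k => k ≤ {v | P v}.ncard
  | .boxLt k => ¬ k ≤ {v | ¬ P v}.ncard
  | .diaEq k => {v | P v}.ncard = k
  | .boxNe k => ¬ {v | ¬ P v}.ncard = k

/-- Truth of a formula at a point of a model. -/
def Form.Sat (M : Model τ n) : Form τ → Fin n → Prop
  | .modProp m ψ, _ => m.Holds (fun v : Fin n => ψ.Sat M v)
  | .mod m φ, _ => m.Holds (fun v : Fin n => φ.Sat M v)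
  | .and φ₁ φ₂, w => φ₁.Sat M w ∧ φ₂.Sat M w
  | .or φ₁ φ₂, w => φ₁.Sat M w ∨ φ₂.Sat M w

/-- Point-free truth of a formula in a model: truth at all points. -/
def Form.True (M : Model τ n) (φ : Form τ) : Prop := ∀ w : Fin n, φ.Sat M w

/-- Counting depth of a single modality. -/
def Modality.depth : Modality → ℕ
  | .diaGe k => k
  | .boxLt k => k
  | .diaEq k => k + 1
  | .boxNe k => k + 1

/-- Counting depth of a formula: the largest counting depth of a modality that occurs in it. -/
def Form.depth : Form τ → ℕ
  | .modProp m _ => m.depth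
  | .mod m φ => max m.depth φ.depth
  | .and φ₁ φ₂ => max φ₁.depth φ₂.depth
  | .or φ₁ φ₂ => max φ₁.depth φ₂.depth

/-- Size of a propositional formula: literals have size one. -/
def PropForm.size : PropForm τ → ℕ
  | .pos _ => 1
  | .neg _ => 1
  | .and ψ₁ ψ₂ => ψ₁.size + ψ₂.size + 1
  | .or ψ₁ ψ₂ => ψ₁.size + ψ₂.size + 1

/-- What a modality adds to the size of a formula. -/
def Modality.size : Modality → ℕ
  | .diaGe k => k
  | .boxLt k => k
  | .diaEq k => k + 1
  | .boxNe k => k + 1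

/-- Size of a formula. -/
def Form.size : Form τ → ℕ
  | .modProp m ψ => ψ.size + m.size
  | .mod m φ => φ.size + m.size
  | .and φ₁ φ₂ => φ₁.size + φ₂.size + 1
  | .or φ₁ φ₂ => φ₁.size + φ₂.size + 1

/-- The formula `φ` defines the set `K` of models with domain of `n` points. -/
def Defines (φ : Form τ) (K : Set (Model τ n)) : Prop :=
  ∀ M : Model τ n, φ.True M ↔ M ∈ K

/-- Definability of a set of models by a formula of counting depth at most `d`. -/
def Definable (d : ℕ) (K : Set (Model τ n)) : Prop :=
  ∃ φ : Form τ, φ.depth ≤ d ∧ Defines φ K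

/-- The description complexity of a set of models: the minimum size of a formula of counting
depth at most `d` that defines it. It is meaningful for sets that are definable in this way. -/
noncomputable def descComplexity (d : ℕ) (K : Set (Model τ n)) : ℕ :=
  sInf {s : ℕ | ∃ φ : Form τ, φ.depth ≤ d ∧ Defines φ K ∧ φ.size = s}

/-- Equivalence of models with respect to all formulas of counting depth at most `d`. -/
def equivD (τ : Type u) (n d : ℕ) : Setoid (Model τ n) where
  r M N := ∀ φ : Form τ, φ.depth ≤ d → (φ.True M ↔ φ.True N)
  iseqv :=
    { refl := fun _ _ _ => Iff.rfl
      symm := fun h φ hφ => (h φ hφ).symm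
      trans := fun h₁ h₂ φ hφ => (h₁ φ hφ).trans (h₂ φ hφ) }

/-- The propositional type that the point `w` realizes in `M`. -/
def typeAt (M : Model τ n) (w : Fin n) : PType τ := fun p => M p w

/-- The number of points of `M` that realize the type `π`. -/
noncomputable def count (M : Model τ n) (π : PType τ) : ℕ := {w | typeAt M w = π}.ncard

/-- Tuples `(n_π)`, indexed by the types `π` over `τ`, that are `(n, d)`-admissible. -/
def Admissible [Fintype τ] [DecidableEq τ] (n d : ℕ) (nbar : PType τ → ℕ) : Prop :=
  (∀ i, nbar i ≤ d) ∧ ∑ i, nbar i ≤ n ∧ ((∃ i, nbar i = d) ∨ ∑ i, nbar i = n)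

/-- The class of the models with domain of `n` points in which each type `i` is realized exactly
`nbar i` times if `nbar i < d`, and at least `d` times if `nbar i = d`. -/
def tupleClass (n d : ℕ) (nbar : PType τ → ℕ) : Set (Model τ n) :=
  {M | ∀ i, (nbar i < d → count M i = nbar i) ∧ (nbar i = d → d ≤ count M i)}

/-- The constant `c_τ = 2^|τ| (2|τ| + 1) - 1`. -/
def cConst (τ : Type u) [Fintype τ] : ℕ :=
  2 ^ Fintype.card τ * (2 * Fintype.card τ + 1) - 1

end GMLU

namespace GMLU

universe u

variable {τ : Type u} {n : ℕ}

/-! Call an occurrence of a modality applied to a propositional formula an atom. It tests the number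
of points whose type lies in a set S, and a formula sees a model only through its atoms
(`Form.true_congr_of_atoms`). An atom that separates counts a and b has size above min(a, b)
(`Modality.min_lt_size`), so depth d cannot separate two counts that are both at least d.

For the lower bounds, move a point from type i to type k so that the class is left. Some atom must
notice, so S contains exactly one of i, k, and the size of the atom bounds the number of points in S
(`exists_atom_of_move`). Once the sets of such atoms cover the types, their sizes add up to at least
the required count (`sum_le_sum_of_cover`).

The upper bounds come from a conjunction with one counting constraint per type; in case 2 the
largest type is left out, since the total n determines it. -/

/-- Truth of a propositional formula at a propositional type. -/
def PropForm.Eval (π : PType τ) : PropForm τ → Prop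
  | .pos p => π p = true
  | .neg p => π p = false
  | .and ψ₁ ψ₂ => ψ₁.Eval π ∧ ψ₂.Eval π
  | .or ψ₁ ψ₂ => ψ₁.Eval π ∨ ψ₂.Eval π

theorem PropForm.sat_iff_eval (M : Model τ n) (w : Fin n) (ψ : PropForm τ) :
    ψ.Sat M w ↔ ψ.Eval (typeAt M w) := by
  induction ψ with
  | pos p => rfl
  | neg p => rfl
  | and ψ₁ ψ₂ h₁ h₂ => simp only [PropForm.Sat, PropForm.Eval, h₁, h₂]
  | or ψ₁ ψ₂ h₁ h₂ => simp only [PropForm.Sat, PropForm.Eval, h₁, h₂]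

/-! ### Modalities as tests on counts, and the atoms of a formula -/

/-- The condition that a modality imposes on the number of points it counts. -/
def Modality.Accepts (c : ℕ) : Modality → Prop
  | .diaGe k => k ≤ c
  | .boxLt k => ¬ k ≤ c
  | .diaEq k => c = k
  | .boxNe k => ¬ c = k

theorem Modality.depth_eq_size (m : Modality) : m.depth = m.size := by
  cases m <;> rfl

theorem Modality.min_lt_size {m : Modality} {a b : ℕ} (h : ¬ (m.Accepts a ↔ m.Accepts b)) :
    min a b < m.size := by
  cases m <;> simp only [Modality.Accepts, Modality.size] at * <;> omega

theorem ncard_typeAt_mem (M : Model τ n) (S : Finset (PType τ)) :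
    {w | typeAt M w ∈ S}.ncard = ∑ i ∈ S, count M i := by
  classical
  have h₁ : {w | typeAt M w ∈ S}.ncard = (Finset.univ.filter (fun w => typeAt M w ∈ S)).card := by
    rw [← Set.ncard_coe_finset]
    simp
  rw [h₁, Finset.card_eq_sum_card_fiberwise (f := typeAt M) (t := S)
    (fun w hw => by simpa using hw)]
  refine Finset.sum_congr rfl fun i hi => ?_
  rw [count, ← Set.ncard_coe_finset]
  congr 1
  ext w
  simp only [Finset.coe_filter, Finset.mem_filter, Finset.mem_univ, true_and, Set.mem_ofPred_eq]
  exact ⟨fun h => h.2, fun h => ⟨h ▸ hi, h⟩⟩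

/-- The occurrences in a formula of modalities applied to propositional formulas. -/
def Form.atoms : Form τ → List (Modality × PropForm τ)
  | .modProp m ψ => [(m, ψ)]
  | .mod _ φ => φ.atoms
  | .and φ₁ φ₂ => φ₁.atoms ++ φ₂.atoms
  | .or φ₁ φ₂ => φ₁.atoms ++ φ₂.atoms

theorem Form.sum_atoms_le_size (φ : Form τ) : (φ.atoms.map (fun a => a.1.size)).sum ≤ φ.size := by
  induction φ with
  | modProp m ψ => simp [Form.atoms, Form.size]
  | mod m φ h => simp only [Form.atoms, Form.size]; omega
  | and φ₁ φ₂ h₁ h₂ =>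
    simp only [Form.atoms, Form.size, List.map_append, List.sum_append]; omega
  | or φ₁ φ₂ h₁ h₂ =>
    simp only [Form.atoms, Form.size, List.map_append, List.sum_append]; omega

theorem Form.size_le_depth_of_mem_atoms {φ : Form τ} {a : Modality × PropForm τ}
    (ha : a ∈ φ.atoms) : a.1.size ≤ φ.depth := by
  induction φ with
  | modProp m ψ =>
    obtain rfl : a = (m, ψ) := by simpa [Form.atoms] using ha
    exact (Modality.depth_eq_size m).ge
  | mod m φ h => exact (h ha).trans (le_max_right _ _)
  | and φ₁ φ₂ h₁ h₂ =>
    rcases List.mem_append.1 ha with h | h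
    · exact (h₁ h).trans (le_max_left _ _)
    · exact (h₂ h).trans (le_max_right _ _)
  | or φ₁ φ₂ h₁ h₂ =>
    rcases List.mem_append.1 ha with h | h
    · exact (h₁ h).trans (le_max_left _ _)
    · exact (h₂ h).trans (le_max_right _ _)

/-- Weighted union bound: only sets whose weight is within their budget serve as witnesses, so the
list may contain others at no harm. -/
theorem sum_le_sum_of_cover {α β : Type*} [DecidableEq α] (S : β → Finset α) (s : β → ℕ)
    (c : α → ℕ) (L : List β) (U : Finset α)
    (h : ∀ u ∈ U, 0 < c u → ∃ a ∈ L, u ∈ S a ∧ ∑ x ∈ S a, c x ≤ s a) :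
    ∑ u ∈ U, c u ≤ (L.map s).sum := by
  induction L generalizing U with
  | nil =>
    rw [Finset.sum_eq_zero]
    · simp
    · intro u hu
      by_contra hc
      simpa using h u hu (by omega)
  | cons a L ih =>
    rw [List.map_cons, List.sum_cons]
    by_cases ha : ∑ x ∈ S a, c x ≤ s a
    · have h₁ : ∑ u ∈ U \ S a, c u ≤ (L.map s).sum := by
        refine ih _ fun u hu hc => ?_
        rw [Finset.mem_sdiff] at hu
        obtain ⟨b, hb, hub, hbs⟩ := h u hu.1 hc
        rcases List.mem_cons.1 hb with rfl | hb
        · exact absurd hub hu.2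
        · exact ⟨b, hb, hub, hbs⟩
      have h₂ : ∑ u ∈ U, c u ≤ ∑ u ∈ U \ S a, c u + ∑ u ∈ S a, c u := by
        rw [← Finset.sum_union Finset.sdiff_disjoint]
        exact Finset.sum_le_sum_of_subset (by simp)
      omega
    · refine (ih U fun u hu hc => ?_).trans (Nat.le_add_left _ _)
      obtain ⟨b, hb, hub, hbs⟩ := h u hu hc
      rcases List.mem_cons.1 hb with rfl | hb
      · exact absurd hbs ha
      · exact ⟨b, hb, hub, hbs⟩

/-! ### Conjunctions, their sizes, and description complexity -/

theorem exists_propForm_conj {ι : Type*} {s : Finset ι} (hs : s.Nonempty) (f : ι → PropForm τ) :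
    ∃ ψ : PropForm τ, (∀ π, ψ.Eval π ↔ ∀ i ∈ s, (f i).Eval π) ∧
      ψ.size + 1 = ∑ i ∈ s, ((f i).size + 1) := by
  induction hs using Finset.Nonempty.cons_induction with
  | singleton a => exact ⟨f a, by simp, by simp⟩
  | cons a s ha hs ih =>
    obtain ⟨ψ, h₁, h₂⟩ := ih
    refine ⟨.and (f a) ψ, fun π => ?_, ?_⟩
    · simp [PropForm.Eval, h₁]
    · rw [Finset.sum_cons, ← h₂, PropForm.size]; omega

theorem exists_form_conj {ι : Type*} {s : Finset ι} (hs : s.Nonempty) (f : ι → Form τ) {d : ℕ}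
    (hd : ∀ i ∈ s, (f i).depth ≤ d) :
    ∃ φ : Form τ, φ.depth ≤ d ∧
      (∀ (M : Model τ n) (w : Fin n), φ.Sat M w ↔ ∀ i ∈ s, (f i).Sat M w) ∧
      φ.size + 1 = ∑ i ∈ s, ((f i).size + 1) := by
  induction hs using Finset.Nonempty.cons_induction with
  | singleton a => exact ⟨f a, hd a (by simp), by simp, by simp⟩
  | cons a s ha hs ih =>
    obtain ⟨φ, h₀, h₁, h₂⟩ := ih fun i hi => hd i (Finset.mem_cons_of_mem hi)
    refine ⟨.and (f a) φ, max_le (hd a (Finset.mem_cons_self a s)) h₀, fun M w => ?_, ?_⟩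
    · simp [Form.Sat, h₁]
    · rw [Finset.sum_cons, ← h₂, Form.size]; omega

theorem descComplexity_le {d : ℕ} {K : Set (Model τ n)} {φ : Form τ} (hφ : φ.depth ≤ d)
    (hdef : Defines φ K) : descComplexity d K ≤ φ.size :=
  Nat.sInf_le ⟨φ, hφ, hdef, rfl⟩

theorem le_descComplexity {d s : ℕ} {K : Set (Model τ n)} (hK : Definable d K)
    (h : ∀ φ : Form τ, φ.depth ≤ d → Defines φ K → s ≤ φ.size) : s ≤ descComplexity d K := by
  obtain ⟨φ, hφ, hdef⟩ := hK
  refine le_csInf ⟨_, φ, hφ, hdef, rfl⟩ ?_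
  rintro _ ⟨χ, hχ, hdef', rfl⟩
  exact h χ hχ hdef'

theorem exists_propForm_type [Fintype τ] [Nonempty τ] (π : PType τ) :
    ∃ ψ : PropForm τ, (∀ ρ, ψ.Eval ρ ↔ ρ = π) ∧ ψ.size + 1 = 2 * Fintype.card τ := by
  obtain ⟨ψ, h₁, h₂⟩ := exists_propForm_conj (Finset.univ_nonempty (α := τ))
    (fun p => if π p = true then PropForm.pos p else PropForm.neg p)
  refine ⟨ψ, fun ρ => ?_, ?_⟩
  · rw [h₁, funext_iff]
    refine forall_congr' fun p => ?_
    cases h : π p <;> simp [PropForm.Eval]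
  · have h (p : τ) : (if π p = true then PropForm.pos p else PropForm.neg p).size = 1 := by
      split_ifs <;> rfl
    simp [h₂, h, mul_comm]

/-- A formula for the constraint that a tuple imposes on the number of points of a single type. -/
theorem exists_form_count [Fintype τ] [Nonempty τ] {d k : ℕ} (hk : k ≤ d) (π : PType τ) :
    ∃ φ : Form τ, φ.depth ≤ d ∧ φ.size ≤ k + 2 * Fintype.card τ ∧
      ∀ (M : Model τ n) (w : Fin n), φ.Sat M w ↔
        (k < d → count M π = k) ∧ (k = d → d ≤ count M π) := by
  obtain ⟨ψ, h₁, h₂⟩ := exists_propForm_type π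
  have hset (M : Model τ n) : {v | ψ.Sat M v}.ncard = count M π := by
    simp [PropForm.sat_iff_eval, h₁, count]
  -- The `+ 1` in the cost of `diaEq k` uses up the slack left by the `2|τ| - 1` symbols of `ψ`.
  rcases hk.lt_or_eq with hk | rfl
  · refine ⟨.modProp (.diaEq k) ψ, hk, ?_, fun M w => ?_⟩
    · simp only [Form.size, Modality.size]; omega
    · simp only [Form.Sat, Modality.Holds, hset, hk, hk.ne, true_imp_iff, false_imp_iff, and_true]
  · refine ⟨.modProp (.diaGe k) ψ, le_rfl, ?_, fun M w => ?_⟩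
    · simp only [Form.size, Modality.size]; omega
    · simp only [Form.Sat, Modality.Holds, hset, lt_irrefl, true_imp_iff, false_imp_iff, true_and]

/-! ### Truth as a function of the counts of types -/

section Counting

variable [Fintype τ] [DecidableEq τ]

open Classical in
/-- The types whose realizing points are counted by a modality applied to a propositional
formula: those satisfying the formula for a diamond, those refuting it for a box. -/
noncomputable def counted (ψ : PropForm τ) : Modality → Finset (PType τ)
  | .diaGe _ => {π | ψ.Eval π}
  | .boxLt _ => {π | ¬ ψ.Eval π}
  | .diaEq _ => {π | ψ.Eval π}
  | .boxNe _ => {π | ¬ ψ.Eval π}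

theorem sum_count (M : Model τ n) : ∑ i, count M i = n := by
  rw [← ncard_typeAt_mem]
  simp [Set.ncard_univ]

theorem holds_iff_accepts (M : Model τ n) (m : Modality) (ψ : PropForm τ) :
    m.Holds (fun v : Fin n => ψ.Sat M v) ↔ m.Accepts (∑ i ∈ counted ψ m, count M i) := by
  rw [← ncard_typeAt_mem]
  cases m <;> simp [Modality.Holds, Modality.Accepts, counted, PropForm.sat_iff_eval]

theorem exists_model_count_eq (c : PType τ → ℕ) (hc : ∑ i, c i = n) :
    ∃ M : Model τ n, ∀ i, count M i = c i := by
  have e : Fin n ≃ (Σ i : PType τ, Fin (c i)) := by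
    refine (Fintype.equivFinOfCardEq ?_).symm
    simp [hc]
  refine ⟨fun p w => (e w).1 p, fun i => ?_⟩
  have h : {w | typeAt (fun p w => (e w).1 p) w = i} = e ⁻¹' (Set.range (Sigma.mk i)) := by
    ext w
    simp only [Set.mem_ofPred_eq, Set.mem_preimage, Set.mem_range]
    constructor
    · rintro rfl
      exact ⟨(e w).2, rfl⟩
    · rintro ⟨y, hy⟩
      exact congrArg Sigma.fst hy.symm
  rw [count, h, Set.ncard_preimage_of_injective_subset_range e.injective
    (by simp [e.surjective.range_eq]), ← Nat.card_coe_set_eq,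
    Nat.card_range_of_injective sigma_mk_injective]
  simp

/-- A nested modality depends only on the set of points satisfying its argument, so agreement on
atoms propagates upward. -/
theorem Form.sat_congr_of_atoms {M N : Model τ n} {φ : Form τ}
    (h : ∀ a ∈ φ.atoms, (a.1.Accepts (∑ i ∈ counted a.2 a.1, count M i) ↔
      a.1.Accepts (∑ i ∈ counted a.2 a.1, count N i))) (w : Fin n) :
    φ.Sat M w ↔ φ.Sat N w := by
  induction φ generalizing w with
  | modProp m ψ =>
    simp only [Form.Sat, holds_iff_accepts]
    exact h (m, ψ) (by simp [Form.atoms])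
  | mod m φ ih =>
    have : (fun v => φ.Sat M v) = fun v => φ.Sat N v := funext fun v => propext (ih h v)
    simp only [Form.Sat, this]
  | and φ₁ φ₂ h₁ h₂ =>
    simp only [Form.atoms, List.mem_append] at h
    simp only [Form.Sat, h₁ (fun a ha => h a (.inl ha)), h₂ (fun a ha => h a (.inr ha))]
  | or φ₁ φ₂ h₁ h₂ =>
    simp only [Form.atoms, List.mem_append] at h
    simp only [Form.Sat, h₁ (fun a ha => h a (.inl ha)), h₂ (fun a ha => h a (.inr ha))]

theorem Form.true_congr_of_atoms {M N : Model τ n} {φ : Form τ}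
    (h : ∀ a ∈ φ.atoms, (a.1.Accepts (∑ i ∈ counted a.2 a.1, count M i) ↔
      a.1.Accepts (∑ i ∈ counted a.2 a.1, count N i))) :
    φ.True M ↔ φ.True N :=
  forall_congr' (Form.sat_congr_of_atoms h)

/-- If a formula detects every move of a point from type `i` to type `j`, then one of its atoms
counts a set of types containing exactly one of them, and is large enough to do so. -/
theorem exists_atom_of_move {φ : Form τ} {M : Model τ n} {i j : PType τ} (hij : i ≠ j)
    (hi : 0 < count M i) (hM : φ.True M)
    (hN : ∀ N : Model τ n, count N i + 1 = count M i → count N j = count M j + 1 → ¬ φ.True N) :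
    ∃ a ∈ φ.atoms,
      (i ∈ counted a.2 a.1 ∧ ∑ x ∈ counted a.2 a.1, count M x ≤ a.1.size) ∨
      (j ∈ counted a.2 a.1 ∧ ∑ x ∈ counted a.2 a.1, count M x < a.1.size) := by
  -- `b` counts the points other than the one moved, which avoids subtraction below.
  obtain ⟨b, hb⟩ : ∃ b : PType τ → ℕ, ∀ x, count M x = b x + (Pi.single i 1 : PType τ → ℕ) x := by
    refine ⟨fun x => count M x - (Pi.single i 1 : PType τ → ℕ) x, fun x => ?_⟩
    by_cases hx : x = i
    · subst hx; simp; omega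
    · simp [hx]
  have hS (S : Finset (PType τ)) : ∑ x ∈ S, count M x = ∑ x ∈ S, b x + if i ∈ S then 1 else 0 := by
    simp only [hb, Finset.sum_add_distrib, Finset.sum_pi_single']
  obtain ⟨N, hNb⟩ := exists_model_count_eq (n := n)
    (fun x => b x + (Pi.single j 1 : PType τ → ℕ) x) (by
      have := hS Finset.univ
      rw [sum_count] at this
      simp only [Finset.sum_add_distrib, Finset.sum_pi_single']
      simpa using this.symm)
  have hS' (S : Finset (PType τ)) :
      ∑ x ∈ S, count N x = ∑ x ∈ S, b x + if j ∈ S then 1 else 0 := by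
    simp only [hNb, Finset.sum_add_distrib, Finset.sum_pi_single']
  have hfalse : ¬ φ.True N := hN N (by simp [hNb, hb, hij]) (by simp [hNb, hb, hij.symm])
  by_contra! hcon
  refine hfalse ((Form.true_congr_of_atoms fun a ha => ?_).1 hM)
  by_contra hne
  have hmin := Modality.min_lt_size hne
  have hne' : ∑ x ∈ counted a.2 a.1, count M x ≠ ∑ x ∈ counted a.2 a.1, count N x :=
    fun h => hne (by rw [h])
  have h₁ := (hcon a ha).1
  have h₂ := (hcon a ha).2
  have e₁ := hS (counted a.2 a.1)
  have e₂ := hS' (counted a.2 a.1)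
  -- With both or neither in the set its count is unchanged. With only `i` the smaller count is that
  -- of `M` minus one, hence `≤`; with only `j` it is that of `M`, hence `<`.
  by_cases hi' : i ∈ counted a.2 a.1 <;> by_cases hj' : j ∈ counted a.2 a.1 <;>
    simp only [hi', hj', if_true, if_false, true_imp_iff] at h₁ h₂ e₁ e₂ <;> omega

theorem sum_le_size_of_cover (φ : Form τ) (c : PType τ → ℕ) (U : Finset (PType τ))
    (h : ∀ u ∈ U, 0 < c u →
      ∃ a ∈ φ.atoms, u ∈ counted a.2 a.1 ∧ ∑ x ∈ counted a.2 a.1, c x ≤ a.1.size) :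
    ∑ u ∈ U, c u ≤ φ.size :=
  (sum_le_sum_of_cover (fun a : Modality × PropForm τ => counted a.2 a.1) (fun a => a.1.size)
    c φ.atoms U h).trans φ.sum_atoms_le_size

theorem exists_form_counts [Nonempty τ] (hn : 0 < n) {d : ℕ} {nbar : PType τ → ℕ}
    (hle : ∀ i, nbar i ≤ d) {s : Finset (PType τ)} (hs : s.Nonempty) :
    ∃ φ : Form τ, φ.depth ≤ d ∧ φ.size ≤ ∑ i ∈ s, nbar i + cConst τ ∧
      ∀ M : Model τ n, φ.True M ↔
        ∀ i ∈ s, (nbar i < d → count M i = nbar i) ∧ (nbar i = d → d ≤ count M i) := by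
  choose f hf₁ hf₂ hf₃ using fun i => exists_form_count (n := n) (hle i) i
  obtain ⟨φ, h₀, h₁, h₂⟩ := exists_form_conj (n := n) hs f (fun i _ => hf₁ i)
  refine ⟨φ, h₀, ?_, fun M => ?_⟩
  · have hsum : ∑ i ∈ s, ((f i).size + 1) ≤ ∑ i ∈ s, (nbar i + (2 * Fintype.card τ + 1)) :=
      Finset.sum_le_sum fun i _ => by have := hf₂ i; omega
    rw [Finset.sum_add_distrib (f := nbar), Finset.sum_const, smul_eq_mul] at hsum
    have hcard : s.card * (2 * Fintype.card τ + 1) ≤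
        2 ^ Fintype.card τ * (2 * Fintype.card τ + 1) := by
      refine Nat.mul_le_mul_right _ ((Finset.card_le_univ s).trans ?_)
      simp
    rw [cConst]
    omega
  · simp only [Form.True, h₁, hf₃]
    -- In an empty domain every formula would be true; a point is needed to extract the constraints.
    exact ⟨fun h => h ⟨0, hn⟩, fun h _ => h⟩

/-! ### Tuple classes: nonemptiness, equivalence, lower bounds -/

theorem Admissible.exists_mem {d : ℕ} {nbar : PType τ → ℕ} (h : Admissible n d nbar)
    {e : PType τ} (he : nbar e = d) :
    ∃ M ∈ tupleClass n d nbar, (∀ i, nbar i ≤ count M i) ∧ ∀ i ≠ e, count M i = nbar i := by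
  obtain ⟨-, h₂, -⟩ := h
  obtain ⟨M, hM⟩ := exists_model_count_eq (n := n)
    (fun x => nbar x + (Pi.single e (n - ∑ i, nbar i) : PType τ → ℕ) x) (by
      simp only [Finset.sum_add_distrib, Finset.sum_pi_single']
      simp only [Finset.mem_univ, if_true]; omega)
  have hge (i : PType τ) : nbar i ≤ count M i := by rw [hM]; omega
  have hne (i : PType τ) (hi : i ≠ e) : count M i = nbar i := by simp [hM, hi]
  refine ⟨M, fun i => ⟨fun hi => hne i ?_, fun hi => hi ▸ hge i⟩, hge, hne⟩
  rintro rfl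
  omega

theorem Admissible.nonempty_tupleClass {d : ℕ} {nbar : PType τ → ℕ} (h : Admissible n d nbar) :
    (tupleClass n d nbar).Nonempty := by
  rcases h.2.2 with ⟨e, he⟩ | hsum
  · obtain ⟨M, hM, -⟩ := h.exists_mem he
    exact ⟨M, hM⟩
  · obtain ⟨M, hM⟩ := exists_model_count_eq nbar hsum
    exact ⟨M, fun i => ⟨fun _ => hM i, fun hi => by rw [hM, hi]⟩⟩

theorem equivD_of_mem_tupleClass {d : ℕ} {nbar : PType τ → ℕ} (hle : ∀ i, nbar i ≤ d)
    {M N : Model τ n} (hM : M ∈ tupleClass n d nbar) (hN : N ∈ tupleClass n d nbar)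
    {φ : Form τ} (hφ : φ.depth ≤ d) : φ.True M ↔ φ.True N := by
  refine Form.true_congr_of_atoms fun a ha => ?_
  by_contra hne
  have hsize := (Form.size_le_depth_of_mem_atoms ha).trans hφ
  have hmin := Modality.min_lt_size hne
  -- A saturated type in the set pushes both counts to at least `d`; without one the tuple fixes
  -- both counts.
  by_cases hS : ∃ i ∈ counted a.2 a.1, nbar i = d
  · obtain ⟨i, hi, hid⟩ := hS
    have h₁ := Finset.single_le_sum_of_canonicallyOrdered (f := count M) hi
    have h₂ := Finset.single_le_sum_of_canonicallyOrdered (f := count N) hi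
    have h₃ := (hM i).2 hid
    have h₄ := (hN i).2 hid
    omega
  · push Not at hS
    refine hne ?_
    rw [Finset.sum_congr rfl fun i hi => ?_]
    have hlt := lt_of_le_of_ne (hle i) (hS i hi)
    rw [(hM i).1 hlt, (hN i).1 hlt]

/-- For each `u`, put all surplus points on a saturated `e ≠ u`. Then `u` has exactly `nbar u`
points, and losing one to `e` leaves the class. The model varies with `u`, so the cover is weighted
by `nbar`, which bounds every such model from below. -/
theorem Admissible.sum_le_size {d : ℕ} {nbar : PType τ → ℕ} (h : Admissible n d nbar)
    (htwo : ∃ i j, i ≠ j ∧ nbar i = d ∧ nbar j = d) {φ : Form τ} (hφ : φ.depth ≤ d)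
    (hdef : Defines φ (tupleClass n d nbar)) : ∑ i, nbar i ≤ φ.size := by
  refine sum_le_size_of_cover φ nbar _ fun u _ hu => ?_
  obtain ⟨e, heu, he⟩ : ∃ e, u ≠ e ∧ nbar e = d := by
    obtain ⟨i, j, hij, hi, hj⟩ := htwo
    by_cases hui : u = i
    · exact ⟨j, hui ▸ hij, hj⟩
    · exact ⟨i, hui, hi⟩
  obtain ⟨M, hM, hge, hne⟩ := h.exists_mem he
  have hMu := hne u heu
  obtain ⟨a, ha, ⟨hua, hle⟩ | ⟨hea, hlt⟩⟩ := exists_atom_of_move (φ := φ) (M := M) heu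
    (by omega) ((hdef M).2 hM) (fun N hNu _ hN => by
      have h₁ := ((hdef N).1 hN u)
      have h₂ := h.1 u
      rcases h₂.lt_or_eq with h₂ | h₂
      · have := h₁.1 h₂; omega
      · have := h₁.2 h₂; omega)
  · exact ⟨a, ha, hua, (Finset.sum_le_sum fun i _ => hge i).trans hle⟩
  -- A set containing `e` already counts `d` points, too many for an atom of size at most `d`.
  · have h₁ := Finset.single_le_sum_of_canonicallyOrdered (f := count M) hea
    have h₂ := (Form.size_le_depth_of_mem_atoms ha).trans hφ
    have h₃ := hge e
    omega

/-- With at most one saturated type, every move leaves the class, so one model suffices. If some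
realized `u` is uncovered, the moves out of `u` force every other type to be covered. Thus at most
one type is lost, and it is no larger than `j`. -/
theorem sub_count_le_size {d : ℕ} {nbar : PType τ → ℕ} (hle : ∀ i, nbar i ≤ d)
    (htwo : ¬ ∃ i j, i ≠ j ∧ nbar i = d ∧ nbar j = d) {φ : Form τ}
    (hdef : Defines φ (tupleClass n d nbar)) {M : Model τ n} (hM : M ∈ tupleClass n d nbar)
    {j : PType τ} (hj : ∀ i, count M i ≤ count M j) : n - count M j ≤ φ.size := by
  have hpair (i k : PType τ) (hik : i ≠ k) (hi : 0 < count M i) : ∃ a ∈ φ.atoms,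
      (i ∈ counted a.2 a.1 ∧ ∑ x ∈ counted a.2 a.1, count M x ≤ a.1.size) ∨
      (k ∈ counted a.2 a.1 ∧ ∑ x ∈ counted a.2 a.1, count M x < a.1.size) := by
    refine exists_atom_of_move hik hi ((hdef M).2 hM) fun N hNi hNk hN => ?_
    have hN' := (hdef N).1 hN
    by_cases hid : nbar i = d
    · have hkd := lt_of_le_of_ne (hle k) fun hkd => htwo ⟨i, k, hik, hid, hkd⟩
      have h₁ := (hM k).1 hkd
      have h₂ := (hN' k).1 hkd
      omega
    · have hid := lt_of_le_of_ne (hle i) hid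
      have h₁ := (hM i).1 hid
      have h₂ := (hN' i).1 hid
      omega
  have hsum := sum_count M
  by_cases hcov : ∀ u ∈ Finset.univ, 0 < count M u →
      ∃ a ∈ φ.atoms, u ∈ counted a.2 a.1 ∧ ∑ x ∈ counted a.2 a.1, count M x ≤ a.1.size
  · have := sum_le_size_of_cover φ (count M) Finset.univ hcov
    omega
  · push Not at hcov
    obtain ⟨u, -, hu, hnot⟩ := hcov
    have h₁ : ∑ i ∈ Finset.univ.erase u, count M i ≤ φ.size := by
      refine sum_le_size_of_cover φ (count M) _ fun v hv _ => ?_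
      obtain ⟨a, ha, ⟨hua, hs⟩ | ⟨hva, hs⟩⟩ := hpair u v (Finset.ne_of_mem_erase hv).symm hu
      · exact absurd hs (hnot a ha hua).not_ge
      · exact ⟨a, ha, hva, hs.le⟩
    have h₂ := Finset.add_sum_erase Finset.univ (count M) (Finset.mem_univ u)
    have h₃ := hj u
    omega

end Counting

end GMLU

theorem mainTheorem2 {τ : Type*} [Fintype τ] [DecidableEq τ] [Nonempty τ]
    (n d : ℕ) (hn : 0 < n) (hd : 0 < d)
    (nbar : GMLU.PType τ → ℕ) (hadm : GMLU.Admissible n d nbar) :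
    GMLU.tupleClass n d nbar ∈ (GMLU.equivD τ n d).classes ∧
    GMLU.Definable d (GMLU.tupleClass n d nbar) ∧
    ((∃ i j, i ≠ j ∧ nbar i = d ∧ nbar j = d) →
      ∑ i, nbar i ≤ GMLU.descComplexity d (GMLU.tupleClass n d nbar) ∧
      GMLU.descComplexity d (GMLU.tupleClass n d nbar) ≤ ∑ i, nbar i + GMLU.cConst τ) ∧
    ((¬ ∃ i j, i ≠ j ∧ nbar i = d ∧ nbar j = d) →
      ∀ j, ∀ M ∈ GMLU.tupleClass n d nbar, (∀ i, GMLU.count M i ≤ GMLU.count M j) →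
        ∑ i ∈ Finset.univ.erase j, nbar i = n - GMLU.count M j ∧
        n - GMLU.count M j ≤ GMLU.descComplexity d (GMLU.tupleClass n d nbar) ∧
        GMLU.descComplexity d (GMLU.tupleClass n d nbar) ≤
          n - GMLU.count M j + GMLU.cConst τ) := by
  classical
  obtain ⟨hle, -, -⟩ := id hadm
  obtain ⟨φ, hφd, hφs, hφ⟩ := GMLU.exists_form_counts hn hle Finset.univ_nonempty
  have hdef : GMLU.Defines φ (GMLU.tupleClass n d nbar) := fun M => by
    simpa [GMLU.tupleClass] using hφ M
  have hdefinable : GMLU.Definable d (GMLU.tupleClass n d nbar) := ⟨φ, hφd, hdef⟩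
  refine ⟨?_, hdefinable, fun htwo => ⟨?_, ?_⟩, fun htwo j M hM hj => ?_⟩
  · obtain ⟨M, hM⟩ := hadm.nonempty_tupleClass
    refine ⟨M, Set.ext fun N => ⟨fun hN χ hχ => ?_, fun hN => ?_⟩⟩
    · exact GMLU.equivD_of_mem_tupleClass hle hN hM hχ
    · exact (hdef N).1 ((hN φ hφd).2 ((hdef M).2 hM))
  · exact GMLU.le_descComplexity hdefinable fun χ hχ hχdef => hadm.sum_le_size htwo hχ hχdef
  · exact (GMLU.descComplexity_le hφd hdef).trans hφs
  -- A saturated `i ≠ j` would have at least `d` points, more than the unsaturated `j`, against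
  -- maximality.
  · have hlt (i : GMLU.PType τ) (hi : i ≠ j) : nbar i < d := by
      refine lt_of_le_of_ne (hle i) fun hid => ?_
      have h₁ := (hM i).2 hid
      have h₂ := hj i
      have h₃ := lt_of_le_of_ne (hle j) fun hjd => htwo ⟨i, j, hi, hid, hjd⟩
      have h₄ := (hM j).1 h₃
      omega
    have hsumN (N : GMLU.Model τ n) :
        GMLU.count N j + ∑ i ∈ Finset.univ.erase j, GMLU.count N i = n := by
      rw [Finset.add_sum_erase _ _ (Finset.mem_univ j), GMLU.sum_count]
    have hbar (N : GMLU.Model τ n) (hN : ∀ i ≠ j, GMLU.count N i = nbar i) :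
        ∑ i ∈ Finset.univ.erase j, GMLU.count N i = ∑ i ∈ Finset.univ.erase j, nbar i :=
      Finset.sum_congr rfl fun i hi => hN i (Finset.ne_of_mem_erase hi)
    have hMbar := hbar M fun i hi => (hM i).1 (hlt i hi)
    have hMsum := hsumN M
    have hsum : ∑ i ∈ Finset.univ.erase j, nbar i = n - GMLU.count M j := by omega
    refine ⟨hsum, ?_, ?_⟩
    · exact GMLU.le_descComplexity hdefinable fun χ _ hχdef =>
        GMLU.sub_count_le_size hle htwo hχdef hM hj
    -- A second type exists as `τ` is nonempty, so the conjunction omitting `j` is not empty.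
    · obtain ⟨k, hk⟩ := exists_ne j
      obtain ⟨χ, hχd, hχs, hχ⟩ := GMLU.exists_form_counts hn hle
        (s := Finset.univ.erase j) ⟨k, by simp [hk]⟩
      rw [← hsum]
      refine (GMLU.descComplexity_le hχd fun N => (hχ N).trans ⟨fun h => ?_,
        fun (h : ∀ i, _) i _ => h i⟩).trans hχs
      have hN (i : GMLU.PType τ) (hi : i ≠ j) : GMLU.count N i = nbar i :=
        (h i (by simp [hi])).1 (hlt i hi)
      have hNbar := hbar N hN
      have hNsum := hsumN N
      intro i
      by_cases hi : i = j
      -- The other counts agree with those of `M` and the totals are both `n`.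
      · have hij : GMLU.count N i = GMLU.count M i := by rw [hi]; omega
        rw [hij]
        exact hM i
      · exact h i (by simp [hi])
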